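/- Terminology. A domain is a nonempty connected open set. A domain $D\subset\mathbb C^N$ is *$\mathbb C$-convex* if for every affine complex line $l$ with $l\cap D\neq\emptyset$ the intersection $l\cap D$ is connected and simply connected. It is *linearly convex* if through every point of $\mathbb C^N\setminus D$ there passes a complex affine hyperplane disjoint from $D$. A *supporting hyperplane* of $D$ at $p\in\partial D$ is a complex affine hyperplane $H$ with $p\in H$ and $H\cap D=\emptyset$. A boundary point $p\in\partial D$ is *strictly $\mathbb C$-convex* if there is a neighbourhood $U$ of $p$ such that $U\cap\overline D\cap H=\{p\}$ for every supporting hyperplane $H$ of $D$ at $p$. A bounded $\mathbb C$-convex domain is called *strictly $\mathbb C$-convex* if all of its boundary points are strictly $\mathbb C$-convex. A boundary point $p\in\partial D$ is *normal* if for every neighbourhood $U$ of $p$ there is a neighbourhood $V\subset U$ of $p$ such that any two points of $V\cap D$ can be joined by a curve lying entirely in $U\cap D$; the domain $D$ is *normal* if all of its boundary points are normal. Theorem. Let $D\subset\mathbb C^{n+m}$ be a bounded strictly $\mathbb C$-convex domain that is normal, and let $\pi:\mathbb C^{n+m}\to\mathbb C^n$ be the projection onto the first $n$ coordinates. Then the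 shadow $\pi(D)\subset\mathbb C^n$ is again a bounded strictly $\mathbb C$-convex (in particular $\mathbb C$-convex and linearly convex) domain, and it is normal. -/

import Mathlib

open Set Filter Topology

/-- Affine complex lines `{a + t v : t ∈ ℂ}`, `v ≠ 0`. -/
def IsComplexLine {E : Type*} [AddCommGroup E] [Module ℂ E] (l : Set E) : Prop :=
  ∃ a v : E, v ≠ 0 ∧ l = Set.range (fun t : ℂ => a + t • v)

/-- Complex affine hyperplanes `{z : f z = c}`, with `f` a nonzero complex linear functional. -/
def IsComplexHyperplane {E : Type*} [AddCommGroup E] [Module ℂ E] (H : Set E) : Prop :=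
  ∃ (f : E →ₗ[ℂ] ℂ) (c : ℂ), f ≠ 0 ∧ H = {z : E | f z = c}

/-- A supporting hyperplane of `D` at `p`: it passes through `p` and misses `D`. -/
def IsSupportingHyperplane {E : Type*} [AddCommGroup E] [Module ℂ E]
    (D : Set E) (p : E) (H : Set E) : Prop :=
  IsComplexHyperplane H ∧ p ∈ H ∧ H ∩ D = ∅

/-- Linear convexity: through every point of the complement of `D` there passes a complex affine
hyperplane that misses `D`. -/
def IsLinearlyConvex {E : Type*} [AddCommGroup E] [Module ℂ E] (D : Set E) : Prop :=
  ∀ p : E, p ∉ D → ∃ H : Set E, IsComplexHyperplane H ∧ p ∈ H ∧ H ∩ D = ∅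

/-- `ℂ`-convexity: the intersection of `D` with every affine complex line that meets `D` is
connected and simply connected. -/
def IsCConvex {E : Type*} [NormedAddCommGroup E] [NormedSpace ℂ E] (D : Set E) : Prop :=
  ∀ l : Set E, IsComplexLine l → (l ∩ D).Nonempty →
    IsConnected (l ∩ D) ∧ IsSimplyConnected (l ∩ D)

/-- A strictly `ℂ`-convex boundary point `p` of `D`: one neighbourhood `U` of `p` serves all the
supporting hyperplanes `H` of `D` at `p`. -/
def IsStrictlyCConvexAt {E : Type*} [NormedAddCommGroup E] [NormedSpace ℂ E]
    (D : Set E) (p : E) : Prop :=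
  ∃ U ∈ 𝓝 p, ∀ H : Set E, IsSupportingHyperplane D p H → U ∩ closure D ∩ H = {p}

/-- A bounded strictly `ℂ`-convex domain: a bounded `ℂ`-convex domain (nonempty connected open
set) all of whose boundary points are strictly `ℂ`-convex. -/
structure IsBoundedStrictlyCConvexDomain {E : Type*} [NormedAddCommGroup E] [NormedSpace ℂ E]
    (D : Set E) : Prop where
  isOpen : IsOpen D
  isConnected : IsConnected D
  isBounded : Bornology.IsBounded D
  isCConvex : IsCConvex D
  strictAt : ∀ p ∈ frontier D, IsStrictlyCConvexAt D p

/-- A normal boundary point `p` of `D`: every neighbourhood `U` of `p` contains a neighbourhood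
`V` of `p` such that any two points of `V ∩ D` are joined by a curve lying in `U ∩ D`. -/
def IsNormalAt {E : Type*} [TopologicalSpace E] (D : Set E) (p : E) : Prop :=
  ∀ U ∈ 𝓝 p, ∃ V ∈ 𝓝 p, V ⊆ U ∧ ∀ w ∈ V ∩ D, ∀ z ∈ V ∩ D, JoinedIn (U ∩ D) w z

/-- Normal domains: every boundary point is normal. -/
def HasNormalBoundary {E : Type*} [TopologicalSpace E] (D : Set E) : Prop :=
  ∀ p ∈ frontier D, IsNormalAt D p

/-- The projection `ℂⁿ⁺ᵐ → ℂⁿ` onto the first `n` coordinates. -/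
def coordProj (n m : ℕ) (z : EuclideanSpace ℂ (Fin (n + m))) : EuclideanSpace ℂ (Fin n) :=
  WithLp.toLp 2 (fun i : Fin n => z (Fin.castAdd m i))

/-! Write `T` for the projection. The main tool is a selection principle, `exists_path_section`,
used both for sets of points and for sets of paths. Two points of `D` in one fibre of `T` are joined
inside their complex line, which lies in that fibre; so the fibres of `D` are path connected and a
loop in a line slice of `T '' D` lifts to a loop in `D`. On the complex lines from its base point to
its moving point the slices of `D` are simply connected, so the coefficient 1 can be deformed to 0
through them. Projected, this contracts the original loop: `T '' D` is ℂ-convex.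

For linear convexity, suppose that every line through `p ∉ D` in a complex plane meets `D`. The
slices are simply connected and omit 0, so selection would produce a nowhere zero section of the
tautological bundle over the projective line; a winding number forbids this. Hence some line misses
`D`, and applying this in quotients shows that a maximal affine subspace through `p` missing `D` is
a hyperplane.

At the boundary, a supporting hyperplane of `T '' D` pulls back to one of `D` containing the whole
fibre. Compactness of `closure D` then transfers strictness. Strictness isolates the points of
`closure D` in the fibre and connectedness of line slices leaves only one, from which normality
descends. -/

open scoped unitInterval

/-! ### Sections of open families over an interval -/

/-- Over `[a, b]` there is a continuous section of the family `W` running from `x` to `y`. -/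
def HasSectionOn {E : Type*} [TopologicalSpace E] (W : ℝ → Set E) (a : ℝ) (x : E) (b : ℝ) (y : E) :
    Prop :=
  ∃ f : ℝ → E, ContinuousOn f (Icc a b) ∧ f a = x ∧ f b = y ∧ ∀ t ∈ Icc a b, f t ∈ W t

theorem HasSectionOn.trans {E : Type*} [TopologicalSpace E] {W : ℝ → Set E} {a b c : ℝ} {x y z : E}
    (hab : a ≤ b) (hbc : b ≤ c) (h₁ : HasSectionOn W a x b y) (h₂ : HasSectionOn W b y c z) :
    HasSectionOn W a x c z := by
  obtain ⟨f, hf, hfa, hfb, hfW⟩ := h₁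
  obtain ⟨τ, hτ, hτb, hτc, hτW⟩ := h₂
  have e1 : EqOn (fun t => if t ≤ b then f t else τ t) f (Icc a b) := fun t ht => by
    simp [ht.2]
  have e2 : EqOn (fun t => if t ≤ b then f t else τ t) τ (Icc b c) := fun t ht => by
    rcases eq_or_lt_of_le ht.1 with h | h
    · subst h; simp [hfb, hτb]
    · simp [not_le.2 h]
  refine ⟨fun t => if t ≤ b then f t else τ t, ?_, ?_, ?_, ?_⟩
  · rw [← Icc_union_Icc_eq_Icc hab hbc]
    exact (hf.congr e1).union_of_isClosed (hτ.congr e2) isClosed_Icc isClosed_Icc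
  · rw [← hfa]; exact e1 ⟨le_rfl, hab⟩
  · rw [← hτc]; exact e2 ⟨hbc, le_rfl⟩
  · intro t ht
    rcases le_total t b with h | h
    · exact (e1 ⟨ht.1, h⟩).symm ▸ hfW t ⟨ht.1, h⟩
    · exact (e2 ⟨h, ht.2⟩).symm ▸ hτW t ⟨h, ht.2⟩

theorem exists_forall_path_mem {E : Type*} [TopologicalSpace E] {W : ℝ → Set E}
    (hW : IsOpen {q : ℝ × E | q.2 ∈ W q.1}) {a : ℝ} {x y : E} (P : Path x y)
    (hP : ∀ u, P u ∈ W a) : ∃ δ > 0, ∀ s, |s - a| ≤ δ → ∀ u, P u ∈ W s := by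
  have h : ∀ᶠ s in 𝓝 a, ∀ u ∈ (univ : Set I), P u ∈ W s := by
    refine isCompact_univ.eventually_forall_of_forall_eventually fun u _ => ?_
    have hc : Continuous fun z : ℝ × I => (z.1, P z.2) := by fun_prop
    exact (hW.preimage hc).mem_nhds (hP u)
  obtain ⟨δ, hδ, h⟩ := Metric.nhds_basis_closedBall.eventually_iff.1 h
  exact ⟨δ, hδ, fun s hs u => h (by simpa [Real.dist_eq] using hs) u trivial⟩

/-- By compactness a path from `x` to `c` in `W a` stays in `W s` for `s` near `a`. It is run
through in that short time, and the section rests at `c` afterwards. -/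
theorem hasSectionOn_of_const_right {E : Type*} [TopologicalSpace E] {W : ℝ → Set E}
    (hW : IsOpen {q : ℝ × E | q.2 ∈ W q.1}) {a b : ℝ} (hab : a < b) {x c : E}
    (hc : ∀ t ∈ Icc a b, c ∈ W t) (hx : JoinedIn (W a) x c) : HasSectionOn W a x b c := by
  obtain ⟨δ, hδ, h⟩ := exists_forall_path_mem hW hx.somePath hx.somePath_mem
  set ε := min δ (b - a)
  have hε : 0 < ε := lt_min hδ (sub_pos.2 hab)
  have hext : ∀ s, s ∈ Icc a b → hx.somePath.extend ((s - a) / ε) ∈ W s := fun s hs => by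
    rcases le_total s (a + ε) with h1 | h1
    · have := h s (by rw [abs_of_nonneg (by linarith [hs.1])]; linarith [min_le_left δ (b - a)])
      rw [hx.somePath.extend_apply ⟨div_nonneg (by linarith [hs.1]) hε.le,
        (div_le_one hε).2 (by linarith)⟩]
      exact this _
    · rw [hx.somePath.extend_of_one_le ((one_le_div hε).2 (by linarith))]
      exact hc s hs
  refine ⟨fun s => hx.somePath.extend ((s - a) / ε), Continuous.continuousOn ?_, by simp, ?_, hext⟩
  · exact hx.somePath.continuous_extend.comp (by fun_prop)
  · exact hx.somePath.extend_of_one_le ((one_le_div hε).2 (min_le_right _ _))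

theorem hasSectionOn_of_const_left {E : Type*} [TopologicalSpace E] {W : ℝ → Set E}
    (hW : IsOpen {q : ℝ × E | q.2 ∈ W q.1}) {a b : ℝ} (hab : a < b) {y c : E}
    (hc : ∀ t ∈ Icc a b, c ∈ W t) (hy : JoinedIn (W b) c y) : HasSectionOn W a c b y := by
  have hW' : IsOpen {q : ℝ × E | q.2 ∈ (fun t => W (-t)) q.1} :=
    hW.preimage (f := fun q : ℝ × E => (-q.1, q.2)) (by fun_prop)
  obtain ⟨f, h1, h2, h3, h4⟩ := hasSectionOn_of_const_right hW' (neg_lt_neg hab) (x := y) (c := c)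
    (fun t ht => hc _ ⟨by linarith [ht.2], by linarith [ht.1]⟩) (by simpa using hy.symm)
  refine ⟨fun t => f (-t), h1.comp (by fun_prop) fun t ht => ⟨neg_le_neg ht.2, neg_le_neg ht.1⟩,
    h3, h2, fun t ht => ?_⟩
  simpa using h4 (-t) ⟨neg_le_neg ht.2, neg_le_neg ht.1⟩

theorem hasSectionOn_zero_one {E : Type*} [TopologicalSpace E] {W : ℝ → Set E}
    (hW : IsOpen {q : ℝ × E | q.2 ∈ W q.1}) (hpc : ∀ t, IsPathConnected (W t)) {x y : E}
    (hx : x ∈ W 0) (hy : y ∈ W 1) : HasSectionOn W 0 x 1 y := by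
  choose c hc using fun t => (hpc t).nonempty
  have hcont : ∀ t, IsOpen {s | c t ∈ W s} := fun t =>
    hW.preimage (f := fun s : ℝ => (s, c t)) (by fun_prop)
  have local_section : ∀ {a b : ℝ}, a < b → (∃ t, Icc a b ⊆ {s | c t ∈ W s}) →
      ∀ {x y : E}, x ∈ W a → y ∈ W b → HasSectionOn W a x b y := by
    rintro a b hab ⟨t, ht⟩ x y hx hy
    have h1 : a < (a + b) / 2 := by linarith
    have h2 : (a + b) / 2 < b := by linarith
    refine .trans h1.le h2.le
      (hasSectionOn_of_const_right hW h1 (c := c t) (fun s hs => ht ⟨hs.1, hs.2.trans h2.le⟩)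
        ((hpc a).joinedIn _ hx _ (ht ⟨le_rfl, hab.le⟩)))
      (hasSectionOn_of_const_left hW h2 (fun s hs => ht ⟨h1.le.trans hs.1, hs.2⟩)
        ((hpc b).joinedIn _ (ht ⟨hab.le, le_rfl⟩) _ hy))
  obtain ⟨t, ht0, htm, ⟨N, hN⟩, hcov⟩ :=
    exists_monotone_Icc_subset_open_cover_unitInterval
      (fun s => (hcont s).preimage (f := ((↑) : I → ℝ)) continuous_subtype_val)
      (fun u _ => mem_iUnion.2 ⟨(u : ℝ), hc u⟩)
  -- The partition is only monotone: while `t n = 0` no time has passed, and only `z = x` could be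
  -- reached.
  have key : ∀ n, (t n : ℝ) = 0 ∨ ∀ z ∈ W (t n), HasSectionOn W 0 x (t n) z := by
    intro n
    induction n with
    | zero => left; simp [ht0]
    | succ n ih =>
      rcases eq_or_lt_of_le (htm n.le_succ) with h | h
      · rw [Nat.succ_eq_add_one] at h
        rwa [← h]
      · right
        intro z hz
        obtain ⟨s, hs⟩ := hcov n
        have hs' : Icc (t n : ℝ) (t (n + 1)) ⊆ {r | c s ∈ W r} := fun r hr =>
          hs (show (⟨r, (t n).2.1.trans hr.1, hr.2.trans (t (n + 1)).2.2⟩ : I) ∈ _ from hr)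
        have hlt : (t n : ℝ) < t (n + 1) := h
        rcases ih with h0 | ih
        · rw [← h0] at hx ⊢
          exact local_section hlt ⟨s, hs'⟩ hx hz
        · exact (ih _ (hc _)).trans (t n).2.1 hlt.le (local_section hlt ⟨s, hs'⟩ (hc _) hz)
  have := key N
  rw [hN N le_rfl] at this
  simpa using (this.resolve_left (by simp)) y (by simpa using hy)

/-- An open family of path connected sets over the unit interval has a continuous section with
prescribed end points. -/
theorem exists_path_section {E : Type*} [TopologicalSpace E] {W : I → Set E}
    (hW : IsOpen {q : I × E | q.2 ∈ W q.1}) (hpc : ∀ t, IsPathConnected (W t)) {x y : E}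
    (hx : x ∈ W 0) (hy : y ∈ W 1) : ∃ f : Path x y, ∀ t, f t ∈ W t := by
  obtain ⟨f, h1, h2, h3, h4⟩ := hasSectionOn_zero_one
    (W := fun t => W (projIcc 0 1 zero_le_one t)) (x := x) (y := y)
    (hW.preimage (f := fun q : ℝ × E => (projIcc 0 1 zero_le_one q.1, q.2))
      ((continuous_projIcc.comp continuous_fst).prodMk continuous_snd)) (fun t => hpc _)
    (by rw [projIcc_left]; exact hx) (by rw [projIcc_right]; exact hy)
  refine ⟨Path.ofLine h1 h2 h3, fun t => ?_⟩
  have : f t ∈ W t := by simpa only [projIcc_val] using h4 t t.2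
  exact this

/-! ### Homotopies between sections -/

theorem isPathConnected_paths {E : Type*} [TopologicalSpace E] {S : Set E}
    (hS : IsSimplyConnected S) {x y : E} (hx : x ∈ S) (hy : y ∈ S) :
    IsPathConnected {P : Path x y | ∀ s, P s ∈ S} := by
  rw [isPathConnected_iff]
  refine ⟨⟨(hS.isPathConnected.joinedIn x hx y hy).somePath, JoinedIn.somePath_mem _⟩, ?_⟩
  intro P hP Q hQ
  have := hS.simplyConnectedSpace
  let lift (R : Path x y) (hR : ∀ s, R s ∈ S) : Path (⟨x, hx⟩ : S) ⟨y, hy⟩ :=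
    { toFun := fun t => ⟨R t, hR t⟩
      source' := by simp
      target' := by simp }
  obtain ⟨F⟩ := SimplyConnectedSpace.paths_homotopic (lift P hP) (lift Q hQ)
  have hc : Continuous fun u : I => (F.eval u).map continuous_subtype_val := by
    rw [Path.continuous_uncurry_iff.symm]
    exact continuous_subtype_val.comp F.continuous
  refine ⟨⟨⟨fun u => (F.eval u).map continuous_subtype_val, hc⟩, ?_, ?_⟩, fun u s => ?_⟩
  · ext s; simp [lift]
  · ext s; simp [lift]
  · exact (F.eval u s).2

/-- Two sections of an open family of simply connected sets over the unit interval are homotopic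
through sections, the homotopy being prescribed over the end points. -/
theorem exists_homotopy_section {E : Type*} [NormedAddCommGroup E] [NormedSpace ℝ E] {W : I → Set E}
    (hW : IsOpen {q : I × E | q.2 ∈ W q.1}) (hsc : ∀ t, IsSimplyConnected (W t))
    (f τ : C(I, E)) (hf : ∀ t, f t ∈ W t) (hτ : ∀ t, τ t ∈ W t)
    (a : Path (f 0) (τ 0)) (ha : ∀ s, a s ∈ W 0) (b : Path (f 1) (τ 1)) (hb : ∀ s, b s ∈ W 1) :
    ∃ H : C(I × I, E), (∀ t s, H (t, s) ∈ W t) ∧ (∀ t, H (t, 0) = f t) ∧ (∀ t, H (t, 1) = τ t) ∧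
      (∀ s, H (0, s) = a s) ∧ ∀ s, H (1, s) = b s := by
  -- Subtracting the segment from `f t` to `τ t` turns paths with moving end points into loops at 0,
  -- a space independent of `t` in which selection applies.
  let lin : I → I → E := fun t s => (1 - (s : ℝ)) • f t + (s : ℝ) • τ t
  have hlin : Continuous fun q : I × I => lin q.1 q.2 := by fun_prop
  let V : I → Set (Path (0 : E) 0) := fun t => {P | ∀ s, P s + lin t s ∈ W t}
  let Φ : ∀ t, Path (f t) (τ t) → Path (0 : E) 0 := fun t P =>
    { toFun := fun s => P s - lin t s
      continuous_toFun := by fun_prop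
      source' := by simp [lin]
      target' := by simp [lin] }
  have hΦ : ∀ t, Continuous (Φ t) := fun t => by
    rw [Path.continuous_uncurry_iff.symm]
    have : Continuous fun q : Path (f t) (τ t) × I => q.1 q.2 := by fun_prop
    exact this.sub (hlin.comp (continuous_const.prodMk continuous_snd))
  have hΦV : ∀ t, V t = Φ t '' {P | ∀ s, P s ∈ W t} := fun t => by
    ext P
    constructor
    · intro hP
      refine ⟨⟨⟨fun s => P s + lin t s, by fun_prop⟩, by simp [lin], by simp [lin]⟩, hP, ?_⟩
      ext s; simp [Φ]
    · rintro ⟨P, hP, rfl⟩ s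
      simpa [Φ] using hP s
  have hVo : IsOpen {q : I × Path (0 : E) 0 | q.2 ∈ V q.1} := by
    rw [isOpen_iff_mem_nhds]
    rintro ⟨t, P⟩ hP
    have : ∀ᶠ q : I × Path (0 : E) 0 in 𝓝 (t, P), ∀ s ∈ (univ : Set I),
        q.2 s + lin q.1 s ∈ W q.1 := by
      refine isCompact_univ.eventually_forall_of_forall_eventually fun s _ => ?_
      have hc : Continuous fun z : (I × Path (0 : E) 0) × I =>
          (z.1.1, z.1.2 z.2 + lin z.1.1 z.2) := by fun_prop
      exact (hW.preimage hc).mem_nhds (hP s)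
    filter_upwards [this] with q hq s using hq s trivial
  obtain ⟨ρ, hρ⟩ := exists_path_section (W := V) hVo (fun t => by
    rw [hΦV]
    exact (isPathConnected_paths (hsc t) (hf t) (hτ t)).image (hΦ t))
    (x := Φ 0 a) (y := Φ 1 b) (by rw [hΦV]; exact ⟨a, ha, rfl⟩) (by rw [hΦV]; exact ⟨b, hb, rfl⟩)
  refine ⟨⟨fun q => ρ q.1 q.2 + lin q.1 q.2, by fun_prop⟩, fun t s => hρ t s, fun t => ?_,
    fun t => ?_, fun s => ?_, fun s => ?_⟩
  · simp [lin]
  · simp [lin]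
  · simp [Φ]
  · simp [Φ]

/-- The sections of an open family of simply connected sets over the unit interval with fixed end
points form a path connected space. -/
theorem isPathConnected_path_sections {E : Type*} [NormedAddCommGroup E] [NormedSpace ℝ E]
    {W : I → Set E} (hW : IsOpen {q : I × E | q.2 ∈ W q.1}) (hsc : ∀ t, IsSimplyConnected (W t))
    {x y : E} (hx : x ∈ W 0) (hy : y ∈ W 1) :
    IsPathConnected {f : Path x y | ∀ t, f t ∈ W t} := by
  rw [isPathConnected_iff]
  refine ⟨exists_path_section hW (fun t => (hsc t).isPathConnected) hx hy, fun f hf τ hτ => ?_⟩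
  obtain ⟨H, hH, h0, h1, ha, hb⟩ := exists_homotopy_section hW hsc f.toContinuousMap τ.toContinuousMap
    hf hτ ((Path.refl x).cast (by simp) (by simp)) (by simpa using hx)
    ((Path.refl y).cast (by simp) (by simp)) (by simpa using hy)
  let K : I → Path x y := fun s =>
    { toFun := fun t => H (t, s)
      source' := by simp [ha]
      target' := by simp [hb] }
  have hK : Continuous K := by
    rw [Path.continuous_uncurry_iff.symm]
    exact H.continuous.comp (continuous_snd.prodMk continuous_fst)
  refine ⟨⟨⟨K, hK⟩, ?_, ?_⟩, fun s t => hH t s⟩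
  · ext t; simpa [K] using h0 t
  · ext t; simpa [K] using h1 t

/-! ### Line slices and ℂ-convexity of images -/

theorem isSimplyConnected_inter_line_iff {E : Type*} [NormedAddCommGroup E] [NormedSpace ℂ E]
    {D : Set E} {a v : E} (hv : v ≠ 0) :
    IsSimplyConnected (range (fun t : ℂ => a + t • v) ∩ D) ↔
      IsSimplyConnected {t : ℂ | a + t • v ∈ D} := by
  have he : Topology.IsEmbedding (fun t : ℂ => a + t • v) :=
    (Homeomorph.addLeft a).isEmbedding.comp
      (isClosedEmbedding_smul_left hv).isEmbedding
  rw [← he.isSimplyConnected_image (s := {t : ℂ | a + t • v ∈ D}), ← image_preimage_eq_range_inter]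
  rfl

theorem isSimplyConnected_univ_complex : IsSimplyConnected (univ : Set ℂ) :=
  have := (Homeomorph.Set.univ ℂ).contractibleSpace
  SimplyConnectedSpace.ofContractible (univ : Set ℂ)

/-- Allowing `v = 0` is harmless, as the slice is then empty or all of ℂ; it lets families of
directions pass through zero. -/
theorem isCConvex_iff_forall_isSimplyConnected {E : Type*} [NormedAddCommGroup E] [NormedSpace ℂ E]
    {D : Set E} : IsCConvex D ↔ ∀ a v : E, {t : ℂ | a + t • v ∈ D}.Nonempty →
      IsSimplyConnected {t : ℂ | a + t • v ∈ D} := by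
  constructor
  · rintro h a v ⟨t, ht⟩
    rcases eq_or_ne v 0 with rfl | hv
    · have : {t : ℂ | a + t • (0 : E) ∈ D} = univ := by
        ext s; simpa using ht
      rw [this]
      exact isSimplyConnected_univ_complex
    · rw [← isSimplyConnected_inter_line_iff hv]
      exact (h _ ⟨a, v, hv, rfl⟩ ⟨_, ⟨t, rfl⟩, ht⟩).2
  · rintro h l ⟨a, v, hv, rfl⟩ ⟨_, ⟨t, rfl⟩, ht⟩
    have := (isSimplyConnected_inter_line_iff hv).2 (h a v ⟨t, ht⟩)
    exact ⟨this.isPathConnected.isConnected, this⟩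

theorem isOpen_slice {E X : Type*} [NormedAddCommGroup E] [NormedSpace ℂ E] [TopologicalSpace X]
    {D : Set E} (hD : IsOpen D) {a v : X → E} (ha : Continuous a) (hv : Continuous v) :
    IsOpen {q : X × ℂ | q.2 ∈ {t : ℂ | a q.1 + t • v q.1 ∈ D}} :=
  hD.preimage (f := fun q : X × ℂ => a q.1 + q.2 • v q.1) (by fun_prop)

/-- A loop in an open `ℂ`-convex set contracts to its base point along complex lines. -/
theorem IsCConvex.exists_contraction {E : Type*} [NormedAddCommGroup E] [NormedSpace ℂ E]
    {D : Set E} (hc : IsCConvex D) (ho : IsOpen D) {p : E} (γ : Path p p) (hγ : ∀ t, γ t ∈ D) :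
    ∃ H : C(I × I, ℂ), (∀ t s, p + H (t, s) • (γ t - p) ∈ D) ∧
      (∀ t, H (t, 0) = 1) ∧ (∀ t, H (t, 1) = 0) := by
  have hp : p ∈ D := by simpa using hγ 0
  -- At both ends `γ t = p` and the slice is all of ℂ, so any path serves.
  let a : Path (1 : ℂ) 0 := (PathConnectedSpace.somePath 1 0)
  obtain ⟨H, hH, h1, h0, -⟩ := exists_homotopy_section
    (W := fun t : I => {z : ℂ | p + z • (γ t - p) ∈ D})
    (isOpen_slice ho (v := fun t => γ t - p) continuous_const (by fun_prop))
    (fun t => isCConvex_iff_forall_isSimplyConnected.1 hc _ _ ⟨0, by simpa using hp⟩)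
    (.const _ 1) (.const _ 0) (by simpa using hγ) (by simpa using hp)
    a (by simpa using hp) a (by simpa using hp)
  exact ⟨H, hH, h1, h0⟩

/-- A linear map with a continuous linear right inverse maps open `ℂ`-convex sets to
`ℂ`-convex sets. -/
theorem IsCConvex.image {E F : Type*} [NormedAddCommGroup E] [NormedSpace ℂ E]
    [NormedAddCommGroup F] [NormedSpace ℂ F] {D : Set E} (hc : IsCConvex D) (ho : IsOpen D)
    (T : E →L[ℂ] F) (S : F →L[ℂ] E) (hTS : ∀ x, T (S x) = x) : IsCConvex (T '' D) := by
  have hs := isCConvex_iff_forall_isSimplyConnected.1 hc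
  refine isCConvex_iff_forall_isSimplyConnected.2 fun a v hne => ?_
  have joined : ∀ x ∈ D, ∀ y ∈ D, JoinedIn {t : ℂ | x + t • (y - x) ∈ D} 0 1 := fun x hx y hy =>
    (hs x (y - x) ⟨0, by simpa using hx⟩).isPathConnected.joinedIn _ (by simpa using hx) _
      (by simpa using hy)
  rw [isSimplyConnected_iff_exists_homotopy_refl_forall_mem]
  refine ⟨isPathConnected_iff.2 ⟨hne, ?_⟩, ?_⟩
  · rintro t ⟨x, hx, hxt⟩ s ⟨y, hy, hys⟩
    have hcont : Continuous fun z : ℂ => t + z • (s - t) := by fun_prop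
    have := (joined x hx y hy).map_continuousOn hcont.continuousOn
    simp only [zero_smul, add_zero, one_smul, add_sub_cancel] at this
    refine this.mono ?_
    rintro _ ⟨z, hz, rfl⟩
    refine ⟨_, hz, ?_⟩
    simp only [map_add, map_smul, map_sub, hxt, hys]
    module
  · intro c₀ c hcD
    let K := LinearMap.ker T.toLinearMap
    have hK : ∀ k : K, T k = 0 := fun k => k.2
    let W : I → Set K := fun t => {k | S (a + c t • v) + k ∈ D}
    have hWo : IsOpen {q : I × K | q.2 ∈ W q.1} :=
      ho.preimage (f := fun q : I × K => S (a + c q.1 • v) + q.2) (by fun_prop)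
    have hWpc : ∀ t, IsPathConnected (W t) := fun t => by
      refine isPathConnected_iff.2 ⟨?_, fun k hk k' hk' => ?_⟩
      · obtain ⟨x, hx, hxt⟩ := hcD t
        refine ⟨⟨x - S (a + c t • v), ?_⟩, ?_⟩
        · simp [K, hTS, hxt]
        · simpa [W] using hx
      · have hcont : Continuous fun z : ℂ => k + z • (k' - k) := by fun_prop
        have := (joined _ hk _ hk').map_continuousOn hcont.continuousOn
        simp only [zero_smul, add_zero, one_smul, add_sub_cancel] at this
        refine this.mono ?_
        rintro _ ⟨z, hz, rfl⟩
        simp only [W, mem_ofPred_eq] at hz ⊢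
        convert hz using 1
        push_cast
        module
    obtain ⟨k₀, hk₀⟩ := (hWpc 0).nonempty
    obtain ⟨k, hk⟩ := exists_path_section hWo hWpc hk₀ (y := k₀) (by simpa [W] using hk₀)
    let γ : Path (S (a + c₀ • v) + (k₀ : E)) (S (a + c₀ • v) + k₀) :=
      { toFun := fun t => S (a + c t • v) + k t
        continuous_toFun := by fun_prop
        source' := by simp
        target' := by simp }
    obtain ⟨H, hH, h1, h0⟩ := hc.exists_contraction ho γ hk
    -- The coefficients contracting the lifted loop also contract `c`, since `T` carries each line
    -- upstairs affinely into the given line.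
    refine ⟨{ toFun := fun q => c₀ + H (q.2, q.1) * (c q.2 - c₀)
              map_zero_left := fun t => by simp [h1]
              map_one_left := fun t => by simp [h0]
              prop' := ?_ }, ?_⟩
    · rintro t x (rfl | rfl) <;> simp
    · rintro ⟨s, t⟩
      refine ⟨_, hH t s, ?_⟩
      change T _ = a + (c₀ + H (t, s) * (c t - c₀)) • v
      simp only [γ, Path.coe_mk_mk, map_add, map_smul, map_sub, hTS, hK]
      module

/-! ### Winding numbers and linear convexity -/

/-- Multiplication by the loop `exp (2 π i r)` does not preserve the homotopy class of a path in the
punctured plane. -/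
theorem not_exists_nonvanishing_homotopy {c₀ c₁ : ℂ} (J : C(I × I, ℂ)) (hJ : ∀ q, J q ≠ 0)
    (h0 : ∀ t, J (t, 0) = c₀) (h1 : ∀ t, J (t, 1) = c₁)
    (hr : ∀ r : I, J (1, r) = Complex.exp (2 * Real.pi * Complex.I * (r : ℝ)) * J (0, r)) :
    False := by
  let pr : ℝ → I := projIcc 0 1 zero_le_one
  have hpr : Continuous pr := continuous_projIcc
  let J' : C(ℝ × ℝ, ℂ) := ⟨fun q => J (pr q.1, pr q.2), by fun_prop⟩
  obtain ⟨L', ⟨-, hL'⟩, -⟩ := Complex.isCoveringMapOn_exp.existsUnique_continuousMap_lifts J'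
    (a₀ := 0) (Complex.exp_log (hJ _)) fun _ => hJ _
  let L : I × I → ℂ := fun q => L' (q.1, q.2)
  have hLc : Continuous L := by fun_prop
  have hL : ∀ q, Complex.exp (L q) = J q := fun q =>
    (congrFun hL' ((q.1 : ℝ), (q.2 : ℝ))).trans (by simp [J', pr])
  have const : ∀ g : I → ℂ, Continuous g →
      (∀ t s, Complex.exp (g t) = Complex.exp (g s)) → ∀ t s, g t = g s := fun g hg h =>
    Complex.isCoveringMap_exp.const_of_comp hg fun t s => Subtype.ext (h t s)
  -- The logarithm is constant on the edges `r = 0` and `r = 1`, while its values at `t = 1` and `t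
  -- = 0` differ by `2πir` plus a constant; going around gives `2πi = 0`.
  have e0 := const (fun t => L (t, 0)) (by fun_prop) (fun t s => by simp [hL, h0]) 1 0
  have e1 := const (fun t => L (t, 1)) (by fun_prop) (fun t s => by simp [hL, h1]) 1 0
  have e := const (fun r => L (1, r) - L (0, r) - 2 * Real.pi * Complex.I * (r : ℝ)) (by fun_prop)
    (fun t s => by
      have : ∀ r : I,
          Complex.exp (L (1, r) - L (0, r) - 2 * Real.pi * Complex.I * (r : ℝ)) = 1 := fun r => by
        rw [Complex.exp_sub, Complex.exp_sub, hL, hL, hr, mul_div_assoc, div_self (hJ _), mul_one,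
          div_self (Complex.exp_ne_zero _)]
      rw [this, this]) 1 0
  simp [e0, e1, Real.pi_ne_zero] at e

/-- Through a point outside an open `ℂ`-convex set, every complex plane contains a complex line
which misses the set. -/
theorem IsCConvex.exists_line_disjoint {E : Type*} [NormedAddCommGroup E] [NormedSpace ℂ E]
    {D : Set E} (hc : IsCConvex D) (ho : IsOpen D) {p : E} (hp : p ∉ D) (u v : E) :
    ∃ α β : ℂ, (α ≠ 0 ∨ β ≠ 0) ∧ ∀ z : ℂ, p + z • (α • u + β • v) ∉ D := by
  -- The pair `(A, B)` deforms `(1 - r, r)` at `t = 0` into `exp (-2πir) (1 - r, r)` at `t = 1`,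
  -- fixing the ends `r = 0, 1`. So `exp (2πir)` times a section at `t = 0` is a section at `t = 1`.
  let A : I → I → ℂ := fun t r =>
    (1 - (r : ℝ)) * Complex.exp (-(2 * Real.pi * Complex.I * (r : ℝ) * (t : ℝ)))
  let B : I → I → ℂ := fun t r =>
    (r : ℝ) * Complex.exp (2 * Real.pi * Complex.I * (1 - (r : ℝ)) * (t : ℝ))
  have hAB : ∀ t r, A t r ≠ 0 ∨ B t r ≠ 0 := fun t r => by
    by_cases h : (r : ℝ) = 0
    · simp [A, h]
    · right
      simp only [B]
      exact mul_ne_zero (by exact_mod_cast h) (Complex.exp_ne_zero _)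
  by_contra! hcon
  let w : I → I → E := fun t r => A t r • u + B t r • v
  have hw : Continuous fun q : I × I => w q.1 q.2 := by
    simp only [w, A, B]; fun_prop
  let S : I → I → Set ℂ := fun t r => {z | p + z • w t r ∈ D}
  have hS : ∀ t r, IsSimplyConnected (S t r) := fun t r =>
    isCConvex_iff_forall_isSimplyConnected.1 hc _ _ (hcon _ _ (hAB t r))
  have hSo : ∀ t, IsOpen {q : I × ℂ | q.2 ∈ S t q.1} := fun t =>
    isOpen_slice ho continuous_const (hw.comp (by fun_prop : Continuous fun r : I => (t, r)))
  have hS0 : ∀ t r, (0 : ℂ) ∉ S t r := fun t r => by simpa [S] using hp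
  obtain ⟨c₀, hc₀⟩ := (hS 0 0).nonempty
  obtain ⟨c₁, hc₁⟩ := (hS 0 1).nonempty
  have w0 : ∀ t, w t 0 = w 0 0 := fun t => by simp [w, A, B]
  have w1 : ∀ t, w t 1 = w 0 1 := fun t => by simp [w, A, B]
  have wr : ∀ r : I, Complex.exp (2 * Real.pi * Complex.I * (r : ℝ)) • w 1 r = w 0 r := fun r => by
    simp only [w, A, B, smul_add, smul_smul]
    congr 2
    · rw [mul_left_comm, ← Complex.exp_add]; simp
    · rw [mul_left_comm, ← Complex.exp_add]
      have : 2 * Real.pi * Complex.I * ((r : ℝ) : ℂ) +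
          2 * Real.pi * Complex.I * (1 - ((r : ℝ) : ℂ)) * (((1 : I) : ℝ) : ℂ) =
          2 * Real.pi * Complex.I := by
        push_cast [Set.Icc.coe_one]; ring
      rw [this, Complex.exp_two_pi_mul_I]; simp
  let W : I → Set (Path c₀ c₁) := fun t => {f | ∀ r, f r ∈ S t r}
  have hWpc : ∀ t, IsPathConnected (W t) := fun t =>
    isPathConnected_path_sections (hSo t) (hS t) (by simpa [S, w0] using hc₀)
      (by simpa [S, w1] using hc₁)
  have hWo : IsOpen {q : I × Path c₀ c₁ | q.2 ∈ W q.1} := by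
    rw [isOpen_iff_mem_nhds]
    rintro ⟨t, f⟩ hf
    have : ∀ᶠ q : I × Path c₀ c₁ in 𝓝 (t, f), ∀ r ∈ (univ : Set I),
        p + q.2 r • w q.1 r ∈ D := by
      refine isCompact_univ.eventually_forall_of_forall_eventually fun r _ => ?_
      have hcont : Continuous fun z : (I × Path c₀ c₁) × I => p + z.1.2 z.2 • w z.1.1 z.2 := by
        have := hw.comp (by fun_prop : Continuous fun z : (I × Path c₀ c₁) × I => (z.1.1, z.2))
        simp only [Function.comp_def] at this
        fun_prop
      exact (ho.preimage hcont).mem_nhds (hf r)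
    filter_upwards [this] with q hq r using hq r trivial
  obtain ⟨f, hf⟩ := (hWpc 0).nonempty
  let g : Path c₀ c₁ :=
    { toFun := fun r => Complex.exp (2 * Real.pi * Complex.I * (r : ℝ)) * f r
      continuous_toFun := by fun_prop
      source' := by simp
      target' := by simp }
  have hg : g ∈ W 1 := fun r => by
    have : p + (f r * Complex.exp (2 * Real.pi * Complex.I * (r : ℝ))) • w 1 r ∈ D := by
      rw [mul_smul, wr]; exact hf r
    rw [mul_comm] at this
    exact this
  obtain ⟨ρ, hρ⟩ := exists_path_section hWo hWpc hf hg
  refine not_exists_nonvanishing_homotopy (c₀ := c₀) (c₁ := c₁) ⟨fun q => ρ q.1 q.2, by fun_prop⟩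
    (fun q h => hS0 q.1 q.2 ?_) (fun t => by simp) (fun t => by simp) (fun r => ?_)
  · have := hρ q.1 q.2
    rwa [show ρ q.1 q.2 = 0 from h] at this
  · simp [g]

/-- Nonempty open `ℂ`-convex sets are linearly convex. -/
theorem IsCConvex.isLinearlyConvex {E : Type*} [NormedAddCommGroup E] [NormedSpace ℂ E]
    [FiniteDimensional ℂ E] {D : Set E} (hc : IsCConvex D) (ho : IsOpen D) (hne : D.Nonempty) :
    IsLinearlyConvex D := by
  intro p hp
  obtain ⟨V, hV⟩ := exists_maximal_of_wellFoundedGT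
    (fun V : Submodule ℂ E => ∀ v ∈ V, p + v ∉ D) ⟨⊥, by simpa using hp⟩
  obtain ⟨d, hd⟩ := hne
  have hdV : d - p ∉ V := fun h => hV.prop _ h (by simpa using hd)
  -- The quotient by `V` has dimension at most one: a line missing the image of `D` there would
  -- enlarge `V`.
  have key : ∀ u v : E, ∃ α β : ℂ, (α ≠ 0 ∨ β ≠ 0) ∧ α • u + β • v ∈ V := by
    intro u v
    have : IsClosed (V : Set E) := V.closed_of_finiteDimensional
    obtain ⟨S, hS⟩ := V.mkQ.exists_rightInverse_of_surjective V.range_mkQ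
    have hTc := hc.image ho (LinearMap.toContinuousLinearMap V.mkQ)
      (LinearMap.toContinuousLinearMap S) (fun x => LinearMap.congr_fun hS x)
    have hTo : IsOpen (LinearMap.toContinuousLinearMap V.mkQ '' D) :=
      LinearMap.isOpenMap_of_finiteDimensional V.mkQ V.mkQ_surjective D ho
    obtain ⟨α, β, hαβ, h⟩ := hTc.exists_line_disjoint hTo (p := V.mkQ p)
      (by
        rintro ⟨x, hx, hxp⟩
        refine hV.prop (x - p) ?_ (by simpa using hx)
        exact (Submodule.Quotient.eq V).1 hxp) (V.mkQ u) (V.mkQ v)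
    refine ⟨α, β, hαβ, ?_⟩
    have hle : V ⊔ Submodule.span ℂ {α • u + β • v} ≤ V := by
      refine hV.le_of_ge ?_ le_sup_left
      intro x hx hxD
      obtain ⟨y, hy, z, hz, rfl⟩ := Submodule.mem_sup.1 hx
      obtain ⟨c, rfl⟩ := Submodule.mem_span_singleton.1 hz
      refine h c ⟨_, hxD, ?_⟩
      have hy0 : V.mkQ y = 0 := by simpa using hy
      change V.mkQ _ = _
      simp only [map_add, map_smul, hy0, zero_add]
    exact hle (Submodule.mem_sup_right (Submodule.mem_span_singleton_self _))
  obtain ⟨f, hfd, hfV⟩ := Submodule.exists_le_ker_of_notMem hdV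
  refine ⟨{z | f z = f p}, ⟨f, f p, fun h => hfd (by simp [h]), rfl⟩, rfl, ?_⟩
  refine eq_empty_of_forall_notMem fun z hz => ?_
  obtain ⟨α, β, hαβ, h⟩ := key (d - p) (z - p)
  have hz0 : f (z - p) = 0 := by rw [map_sub, hz.1, sub_self]
  have hα : α = 0 := by
    have := hfV h
    rw [LinearMap.mem_ker, map_add, map_smul, map_smul, hz0, smul_zero, add_zero] at this
    exact (smul_eq_zero.1 this).resolve_right hfd
  have hβ : β ≠ 0 := hαβ.resolve_left (by simp [hα])
  rw [hα, zero_smul, zero_add] at h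
  exact hV.prop _ ((V.smul_mem_iff hβ).1 h) (by simpa using hz.2)

/-! ### Boundary points of the image -/

/-- The set `T '' (K \ N)` is compact, hence closed, and misses `q`. -/
theorem IsCompact.eventually_forall_mem_of_fiber_subset {E F : Type*} [TopologicalSpace E]
    [TopologicalSpace F] [T2Space F] {K N : Set E} (hK : IsCompact K) (hN : IsOpen N) {T : E → F}
    (hT : Continuous T) {q : F} (h : ∀ x ∈ K, T x = q → x ∈ N) :
    ∀ᶠ y in 𝓝 q, ∀ x ∈ K, T x = y → x ∈ N := by
  have hcl : IsClosed (T '' (K \ N)) := ((hK.diff hN).image hT).isClosed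
  have hq : q ∉ T '' (K \ N) := by
    rintro ⟨x, hx, hxq⟩
    exact hx.2 (h x hx.1 hxq)
  filter_upwards [hcl.isOpen_compl.mem_nhds hq] with y hy x hx hxy
  by_contra hxN
  exact hy ⟨x, ⟨hx, hxN⟩, hxy⟩

section Projection

variable {E F : Type*} [NormedAddCommGroup E] [NormedSpace ℂ E] [NormedAddCommGroup F]
  [NormedSpace ℂ F] {D : Set E} {T : E →L[ℂ] F}

theorem IsSupportingHyperplane.preimage (hT : Function.Surjective T) {p : E} {H : Set F}
    (hH : IsSupportingHyperplane (T '' D) (T p) H) : IsSupportingHyperplane D p (T ⁻¹' H) := by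
  obtain ⟨⟨f, c, hf, rfl⟩, hp, hd⟩ := hH
  refine ⟨⟨f ∘ₗ T.toLinearMap, c, fun h => hf ?_, rfl⟩, hp, ?_⟩
  · ext y
    obtain ⟨x, rfl⟩ := hT y
    exact LinearMap.congr_fun h x
  · refine eq_empty_of_forall_notMem fun x hx => ?_
    exact (hd ▸ ⟨hx.1, mem_image_of_mem T hx.2⟩ : T x ∈ (∅ : Set F))

theorem mem_frontier_of_image_mem_frontier {X Y : Type*} [TopologicalSpace X] [TopologicalSpace Y]
    {D : Set X} {f : X → Y} (hf : IsOpenMap f) (ho : IsOpen D) {p : X} (hp : p ∈ closure D)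
    (hq : f p ∈ frontier (f '' D)) : p ∈ frontier D := by
  rw [ho.frontier_eq]
  rw [(hf D ho).frontier_eq] at hq
  exact ⟨hp, fun h => hq.2 (mem_image_of_mem f h)⟩

variable [FiniteDimensional ℂ E]

theorem Bornology.IsBounded.closure_image (hb : Bornology.IsBounded D) :
    closure (T '' D) = T '' closure D :=
  have := FiniteDimensional.proper ℂ E
  (image_closure_of_isCompact hb.isCompact_closure T.continuous.continuousOn).symm

variable [FiniteDimensional ℂ F]

theorem IsBoundedStrictlyCConvexDomain.isStrictlyCConvexAt_image
    (hD : IsBoundedStrictlyCConvexDomain D) (hT : Function.Surjective T) {q : F}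
    (hq : q ∈ frontier (T '' D)) : IsStrictlyCConvexAt (T '' D) q := by
  have := FiniteDimensional.proper ℂ E
  have hTo : IsOpenMap T := T.toLinearMap.isOpenMap_of_finiteDimensional hT
  have hfr : ∀ p ∈ closure D, T p = q → p ∈ frontier D := fun p hp hpq =>
    mem_frontier_of_image_mem_frontier hTo hD.isOpen hp (hpq ▸ hq)
  choose! U hU hUH using hD.strictAt
  -- The fibre may have several points here, so their neighbourhoods are united; the pulled-back
  -- hyperplane supports `D` at each of them.
  let N : Set E := ⋃ p ∈ {p | p ∈ closure D ∧ T p = q}, interior (U p)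
  refine ⟨_, hD.isBounded.isCompact_closure.eventually_forall_mem_of_fiber_subset (N := N)
    (isOpen_biUnion fun _ _ => isOpen_interior) T.continuous fun p hp hpq => ?_, fun H hH => ?_⟩
  · exact mem_biUnion (show p ∈ {p | p ∈ closure D ∧ T p = q} from ⟨hp, hpq⟩)
      (mem_interior_iff_mem_nhds.2 (hU p (hfr p hp hpq)))
  · refine Subset.antisymm ?_ ?_
    · rintro y ⟨⟨hyN, hyc⟩, hyH⟩
      rw [hD.isBounded.closure_image] at hyc
      obtain ⟨x, hx, rfl⟩ := hyc
      obtain ⟨p, hp, hxp⟩ := mem_iUnion₂.1 (hyN x hx rfl)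
      have : x ∈ U p ∩ closure D ∩ T ⁻¹' H := ⟨⟨interior_subset hxp, hx⟩, hyH⟩
      rw [hUH p (hfr p hp.1 hp.2) _ (.preimage hT (hp.2.symm ▸ hH))] at this
      rw [mem_singleton_iff.1 this]
      exact hp.2
    · rintro _ rfl
      refine ⟨⟨fun x hx hxq => ?_, frontier_subset_closure hq⟩, hH.2.1⟩
      exact mem_biUnion (show x ∈ {p | p ∈ closure D ∧ T p = _} from ⟨hx, hxq⟩)
        (mem_interior_iff_mem_nhds.2 (hU x (hfr x hx hxq)))

/-- The closure of a bounded strictly `ℂ`-convex domain meets each fibre of a linear map over a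
boundary point of the image in at most one point. -/
theorem IsBoundedStrictlyCConvexDomain.eq_of_map_eq (hD : IsBoundedStrictlyCConvexDomain D)
    (hT : Function.Surjective T) (hlin : IsLinearlyConvex (T '' D)) {q : F}
    (hq : q ∈ frontier (T '' D)) {x y : E} (hx : x ∈ closure D) (hy : y ∈ closure D)
    (hxq : T x = q) (hyq : T y = q) : x = y := by
  have := FiniteDimensional.proper ℂ E
  by_contra hxy
  have hTo : IsOpenMap T := T.toLinearMap.isOpenMap_of_finiteDimensional hT
  have hfr : ∀ p ∈ closure D, T p = q → p ∈ frontier D := fun p hp hpq =>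
    mem_frontier_of_image_mem_frontier hTo hD.isOpen hp (hpq ▸ hq)
  have hq' : q ∉ T '' D := ((hTo D hD.isOpen).frontier_eq ▸ hq).2
  obtain ⟨H, hH, hqH, hHD⟩ := hlin q hq'
  obtain ⟨U, hU, hUH⟩ := hD.strictAt x (hfr x hx hxq)
  specialize hUH _ (IsSupportingHyperplane.preimage (D := D) hT ⟨hH, hxq.symm ▸ hqH, hHD⟩)
  obtain ⟨e, he, heU⟩ := Metric.nhds_basis_closedBall.mem_iff.1 hU
  -- The sphere of radius `d` about `x` lies in `U` and separates `x` from `y`; strictness keeps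
  -- `closure D` off it in the fibre, hence also over points near `q`.
  set d := min e (dist x y / 2)
  have hxy' : 0 < dist x y := dist_pos.2 hxy
  have hd : 0 < d := lt_min he (by positivity)
  have hd2 : d ≤ dist x y / 2 := min_le_right _ _
  have hev := (hD.isBounded.isCompact_closure.inter_right
    (Metric.isClosed_sphere (x := x) (ε := d))).eventually_forall_mem_of_fiber_subset (N := ∅)
    isOpen_empty T.continuous (q := q) fun z hz hzq => by
      have hz' : z ∈ U ∩ closure D ∩ T ⁻¹' H :=
        ⟨⟨heU (Metric.closedBall_subset_closedBall (min_le_left _ _)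
          (Metric.sphere_subset_closedBall hz.2)), hz.1⟩, by rw [mem_preimage, hzq]; exact hqH⟩
      rw [hUH, mem_singleton_iff] at hz'
      have := Metric.mem_sphere.1 hz.2
      rw [hz', dist_self] at this
      exact absurd this hd.ne
  obtain ⟨r, hr, hev⟩ := Metric.eventually_nhds_iff_ball.1 hev
  have near : ∀ p ∈ closure D, T p = q → ∃ P ∈ D, dist P p < d / 4 ∧ dist (T P) q < r / 3 := by
    intro p hp hpq
    have : Metric.ball p (d / 4) ∩ T ⁻¹' Metric.ball q (r / 3) ∈ 𝓝 p :=
      inter_mem (Metric.ball_mem_nhds _ (by positivity))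
        (T.continuous.continuousAt.preimage_mem_nhds (by
          rw [hpq]; exact Metric.ball_mem_nhds _ (by positivity)))
    obtain ⟨P, hP, hPD⟩ := mem_closure_iff_nhds.1 hp _ this
    exact ⟨P, hPD, hP.1, hP.2⟩
  obtain ⟨P, hPD, hPx, hPq⟩ := near x hx hxq
  obtain ⟨Q, hQD, hQy, hQq⟩ := near y hy hyq
  have hconn : IsPreconnected {z : ℂ | P + z • (Q - P) ∈ D} :=
    (isCConvex_iff_forall_isSimplyConnected.1 hD.isCConvex P (Q - P)
      ⟨0, by simpa using hPD⟩).isPathConnected.isConnected.isPreconnected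
  have hQx : d < dist Q x := by
    have := dist_triangle x Q y
    rw [dist_comm x Q] at this
    linarith
  obtain ⟨z, hz, hzd⟩ := hconn.intermediate_value (a := 0) (b := 1) (by simpa using hPD)
    (by simpa using hQD) (f := fun z => dist (P + z • (Q - P)) x) (by fun_prop)
    (show d ∈ _ by simp only [zero_smul, add_zero, one_smul, add_sub_cancel]
                   constructor <;> linarith)
  -- The crossing point is within `5d/4` of `P`, while `Q` is at least `3d/2` away. So `‖z‖ ≤ 1`,
  -- and three errors below `r/3` keep its image within `r` of `q`.
  have hz1 : ‖z‖ ≤ 1 := by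
    have h1 : ‖z‖ * dist Q P ≤ d + d / 4 := by
      have := dist_triangle_right (P + z • (Q - P)) P x
      rw [dist_eq_norm (P + z • (Q - P)) P, add_sub_cancel_left, norm_smul, ← dist_eq_norm] at this
      simp only at hzd
      linarith
    have h2 : 3 / 2 * d ≤ dist Q P := by
      have h3 := dist_triangle x P y
      have h4 := dist_triangle P Q y
      rw [dist_comm x P] at h3
      rw [dist_comm P Q] at h4
      linarith
    by_contra! h
    nlinarith
  refine hev (T (P + z • (Q - P))) ?_ _ ⟨subset_closure hz, hzd⟩ rfl
  have : T (P + z • (Q - P)) - q = (T P - q) + z • ((T Q - q) - (T P - q)) := by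
    rw [map_add, map_smul, map_sub]; module
  rw [Metric.mem_ball, dist_eq_norm, this]
  calc _ ≤ ‖T P - q‖ + ‖z‖ * ‖(T Q - q) - (T P - q)‖ := by
        rw [← norm_smul]; exact norm_add_le _ _
    _ ≤ ‖T P - q‖ + 1 * (‖T Q - q‖ + ‖T P - q‖) := by
        gcongr; exact norm_sub_le _ _
    _ < r := by rw [← dist_eq_norm, ← dist_eq_norm]; linarith

/-- As only `p` lies over the boundary point, all of `D` over nearby points lies in a normal
neighbourhood of `p`: lift, join there, project. -/
theorem IsBoundedStrictlyCConvexDomain.hasNormalBoundary_image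
    (hD : IsBoundedStrictlyCConvexDomain D) (hN : HasNormalBoundary D)
    (hT : Function.Surjective T) (hlin : IsLinearlyConvex (T '' D)) :
    HasNormalBoundary (T '' D) := by
  have := FiniteDimensional.proper ℂ E
  intro q hq U hU
  have hTo : IsOpenMap T := T.toLinearMap.isOpenMap_of_finiteDimensional hT
  obtain ⟨p, hp, rfl⟩ := hD.isBounded.closure_image (T := T) ▸ frontier_subset_closure hq
  obtain ⟨V, hV, -, hVj⟩ := hN p (mem_frontier_of_image_mem_frontier hTo hD.isOpen hp hq)
    (T ⁻¹' U) (T.continuous.continuousAt.preimage_mem_nhds hU)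
  have hev := hD.isBounded.isCompact_closure.eventually_forall_mem_of_fiber_subset
    (isOpen_interior (s := V)) T.continuous (q := T p) fun x hx hxp => by
      rw [hD.eq_of_map_eq hT hlin hq hx hp hxp rfl]
      exact mem_interior_iff_mem_nhds.2 hV
  refine ⟨_, inter_mem hU hev, inter_subset_left, ?_⟩
  rintro _ ⟨⟨-, hw⟩, w, hwD, rfl⟩ _ ⟨⟨-, hz⟩, z, hzD, rfl⟩
  refine ((hVj w ⟨interior_subset (hw w (subset_closure hwD) rfl), hwD⟩ z
    ⟨interior_subset (hz z (subset_closure hzD) rfl), hzD⟩).map_continuousOn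
    T.continuous.continuousOn).mono ?_
  rintro _ ⟨x, hx, rfl⟩
  exact ⟨hx.1, mem_image_of_mem T hx.2⟩

/-- The image of a bounded strictly `ℂ`-convex domain with normal boundary under a surjective linear
map is again a bounded strictly `ℂ`-convex domain with normal boundary, and linearly convex. -/
theorem IsBoundedStrictlyCConvexDomain.image (hD : IsBoundedStrictlyCConvexDomain D)
    (hN : HasNormalBoundary D) (hT : Function.Surjective T) :
    IsBoundedStrictlyCConvexDomain (T '' D) ∧ IsLinearlyConvex (T '' D) ∧
      HasNormalBoundary (T '' D) := by
  have := FiniteDimensional.proper ℂ E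
  have ho : IsOpen (T '' D) := T.toLinearMap.isOpenMap_of_finiteDimensional hT D hD.isOpen
  obtain ⟨S, hS⟩ := T.toLinearMap.exists_rightInverse_of_surjective (LinearMap.range_eq_top.2 hT)
  have hc : IsCConvex (T '' D) := hD.isCConvex.image hD.isOpen T
    (LinearMap.toContinuousLinearMap S) (fun x => LinearMap.congr_fun hS x)
  have hlin := hc.isLinearlyConvex ho (hD.isConnected.nonempty.image T)
  refine ⟨⟨ho, hD.isConnected.image _ T.continuous.continuousOn, ?_, hc,
    fun q hq => hD.isStrictlyCConvexAt_image hT hq⟩, hlin, hD.hasNormalBoundary_image hN hT hlin⟩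
  exact (hD.isBounded.isCompact_closure.image T.continuous).isBounded.subset
    (image_mono subset_closure)

end Projection

/-! ### The coordinate projection -/

/-- `coordProj` as a linear map. -/
def coordProjₗ (n m : ℕ) : EuclideanSpace ℂ (Fin (n + m)) →ₗ[ℂ] EuclideanSpace ℂ (Fin n) where
  toFun := coordProj n m
  map_add' x y := by ext i; simp [coordProj]
  map_smul' c x := by ext i; simp [coordProj]

theorem coordProj_surjective (n m : ℕ) : Function.Surjective (coordProj n m) := fun y =>
  ⟨WithLp.toLp 2 (Fin.append y (0 : Fin m → ℂ)), by ext i; simp [coordProj]⟩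

theorem mainTheorem2 (n m : ℕ) (D : Set (EuclideanSpace ℂ (Fin (n + m))))
    (hD : IsBoundedStrictlyCConvexDomain D) (hN : HasNormalBoundary D) :
    IsBoundedStrictlyCConvexDomain (coordProj n m '' D) ∧
      IsLinearlyConvex (coordProj n m '' D) ∧
      HasNormalBoundary (coordProj n m '' D) :=
  hD.image (T := LinearMap.toContinuousLinearMap (coordProjₗ n m)) hN (coordProj_surjective n m)
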